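/- **Setting.** There are $K$ arms and a horizon $T\ge 1$; an oblivious adversary fixes rewards $r_{i,t}\in[0,1]$ in advance, and at each time $t\le T$ the player observes only the reward of the arm $i_t$ that it plays. The weak regret is $R_{\mathrm w}(T)=\max_i\sum_{t\le T} r_{i,t}-\sum_{t\le T} r_{i_t,t}$. **HLMC.** Let $2\le D\le\lceil\log_2K\rceil$, $N=\lceil K^{1/D}\rceil$, $S=\lceil T^{1/D}\rceil$ and $\gamma=\min\{1,\sqrt{N\ln N/(2S)}\}$. The arms are arranged in a rooted tree of depth $D$: the root is the set of all arms, each non-leaf group is partitioned into at least one and at most $N$ subgroups of the next level, and the groups at depth $D$ are the single arms. The horizon is one epoch of level $0$; an epoch of level $d<D$ is divided into consecutive epochs of level $d+1$ of length $S^{D-d-1}$ (the last one possibly shorter). In each epoch of level $d<D$ a newly started EXP3 with learning rate $\gamma$ runs over the subgroups of the level-$d$ group selected for this epoch (the root for $d=0$): at the beginning of each level-$(d+1)$ epoch it draws a subgroup, and at the end of it, it is fed the average reward per play obtained in it. A level-$D$ epoch is one play of the selected arm. (EXP3 with learning rate $\gamma$ over $n$ super arms: weights $w_i$, initially $1$;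 draw $j$ with probabilities $p_i=(1-\gamma)w_i/\sum_k w_k+\gamma/n$; after the reward $y$, multiply $w_j$ by $\exp(\gamma y/(np_j))$.) At every level, while its epoch lasts, the policy stores one word for the statistic (weight) of each subgroup of the current group, plus a fixed number $a\ge 0$ of bookkeeping words. Its memory requirement $M$ is the largest number of words in use at a play, over all runs of positive probability. **Theorem.** For every $a\ge0$ there are constants $c_1,c_2,C>0$ such that for all $K$, all $D$ with $2\le D\le\lceil\log_2K\rceil$, all $T\ge1$, every such tree and every reward assignment, $$c_1\,D K^{1/D}\;\le\; M\;\le\; c_2\,D K^{1/D}$$ and $$\mathbb E\,[R_{\mathrm w}(T)]\;\le\; C\,D\,T^{1-\frac1{2D}}\,K^{\frac1{2D}}\,(\ln K)^{1/2}.$$ That is, the memory complexity is $\Theta(DK^{1/D})$, and the expected weak regret is $O(DT^{1-\frac1{2D}}K^{\frac1{2D}})$ up to a logarithmic factor. -/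

import Mathlib

open scoped BigOperators

noncomputable section

/-! ## The EXP3 learning routine -/

/-- Positive weights on `n + 1` (super) arms. -/
abbrev Exp3Weights (n : ℕ) : Type := {w : Fin (n + 1) → ℝ // ∀ i, 0 < w i}

/-- Initialization `w_{i,1} = 1`. -/
def Exp3Weights.init (n : ℕ) : Exp3Weights n := ⟨fun _ => 1, fun _ => one_pos⟩

/-- Selection probabilities of EXP3 with learning rate `γ`:
`p_i = (1 - γ) w_i / ∑ⱼ w_j + γ / (number of arms)`. -/
def Exp3Weights.prob {n : ℕ} (γ : unitInterval) (w : Exp3Weights n) (i : Fin (n + 1)) : ℝ :=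
  (1 - (γ : ℝ)) * (w.1 i / ∑ j, w.1 j) + (γ : ℝ) / ((n : ℝ) + 1)

theorem Exp3Weights.prob_nonneg {n : ℕ} (γ : unitInterval) (w : Exp3Weights n)
    (i : Fin (n + 1)) : 0 ≤ w.prob γ i := by
  have h0 : (0 : ℝ) ≤ γ := γ.2.1
  have h1 : (0 : ℝ) ≤ 1 - γ := sub_nonneg.2 γ.2.2
  have h2 : 0 ≤ w.1 i / ∑ j, w.1 j :=
    div_nonneg (w.2 i).le (Finset.sum_nonneg fun j _ => (w.2 j).le)
  unfold Exp3Weights.prob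
  positivity

theorem Exp3Weights.sum_prob {n : ℕ} (γ : unitInterval) (w : Exp3Weights n) :
    ∑ i, w.prob γ i = 1 := by
  have h : (∑ j, w.1 j) ≠ 0 :=
    (Finset.sum_pos (fun j _ => w.2 j) Finset.univ_nonempty).ne'
  have hn : ((n : ℝ) + 1) ≠ 0 := by positivity
  simp only [Exp3Weights.prob, Finset.sum_add_distrib, ← Finset.mul_sum, ← Finset.sum_div,
    div_self h, Finset.sum_const, Finset.card_univ, Fintype.card_fin, nsmul_eq_mul]
  push_cast
  field_simp
  ring

/-- The law of the arm drawn by EXP3. -/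
def Exp3Weights.draw {n : ℕ} (γ : unitInterval) (w : Exp3Weights n) : PMF (Fin (n + 1)) :=
  PMF.ofFintype (fun i => ENNReal.ofReal (w.prob γ i)) (by
    rw [← ENNReal.ofReal_sum_of_nonneg fun i _ => w.prob_nonneg γ i, w.sum_prob γ,
      ENNReal.ofReal_one])

/-- The weight update `w_i ← w_i exp (γ r̂_i / (number of arms))` with the importance-weighted
estimate `r̂_i = (y / p_i) 𝟙(i = j)`, after arm `j` was drawn and gave the reward `y`. -/
def Exp3Weights.update {n : ℕ} (γ : unitInterval) (w : Exp3Weights n) (j : Fin (n + 1))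
    (y : ℝ) : Exp3Weights n :=
  ⟨fun i => w.1 i * Real.exp ((γ : ℝ) * (if i = j then y / w.prob γ i else 0) / ((n : ℝ) + 1)),
    fun i => mul_pos (w.2 i) (Real.exp_pos _)⟩

/-- `exp3 γ pull feedback m s w` runs EXP3 for `m` more (super) time steps, from step `s` and the
weights `w`. Pulling (super) arm `j` at step `s` has a random outcome with law `pull s j`, which
yields the reward `feedback` of that outcome. The result is the list of outcomes. -/
def exp3 {n : ℕ} {β : Type} (γ : unitInterval) (pull : ℕ → Fin (n + 1) → PMF β)
    (feedback : β → ℝ) : ℕ → ℕ → Exp3Weights n → PMF (List β)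
  | 0, _, _ => PMF.pure []
  | m + 1, s, w =>
    (w.draw γ).bind fun j => (pull s j).bind fun b =>
      (exp3 γ pull feedback m (s + 1) (w.update γ j (feedback b))).map fun l => b :: l

/-! ## Tree-structured hierarchies of arm groups -/

/-- A group of arms from `{0, …, K - 1}` together with its tree of subgroups, `d` levels deep: a
group is either one single arm (`d = 0`) or consists of `n + 1 ≥ 1` groups of depth `d - 1`.
A `D`-level hierarchy is an element of `Hierarchy K D`; its level-`ℓ` groups are the subtrees at
distance `ℓ` from the root, and its level-`D` groups are the arms. -/
inductive Hierarchy (K : ℕ) : ℕ → Type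
  | arm (a : Fin K) : Hierarchy K 0
  | group {d : ℕ} (n : ℕ) (child : Fin (n + 1) → Hierarchy K d) : Hierarchy K (d + 1)

/-- The arms of a group, with multiplicity. -/
def Hierarchy.arms {K : ℕ} : {d : ℕ} → Hierarchy K d → Multiset (Fin K)
  | _, .arm a => {a}
  | _, .group _ child => ∑ j, (child j).arms

/-- Every group consists of at most `N` groups of the next level. -/
def Hierarchy.BranchingLE {K : ℕ} (N : ℕ) : {d : ℕ} → Hierarchy K d → Prop
  | _, .arm _ => True
  | _, .group n child => n + 1 ≤ N ∧ ∀ j, (child j).BranchingLE N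

/-- The number `⌈K^{1/D}⌉` of groups into which a group is divided at every level. -/
def branchingNumber (K D : ℕ) : ℕ := ⌈(K : ℝ) ^ (1 / (D : ℝ))⌉₊

/-- The hierarchies used by HLMC with `K` arms and depth `D`: the subgroups of every group
partition it, down to single arms (so that each of the `K` arms occurs exactly once), and every
group is divided into `⌈K^{1/D}⌉` subgroups, or fewer where there are not enough arms. -/
def Hierarchy.IsHLMC {K D : ℕ} (H : Hierarchy K D) : Prop :=
  H.arms = (Finset.univ : Finset (Fin K)).val ∧ H.BranchingLE (branchingNumber K D)

/-- Such hierarchies exist for every nonempty set of arms and every positive depth. -/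
theorem Hierarchy.exists_isHLMC {K D : ℕ} (hK : 1 ≤ K) (hD : 1 ≤ D) :
    ∃ H : Hierarchy K D, H.IsHLMC := by
  have key : ∀ (N d : ℕ), 1 ≤ N → ∀ s : Multiset (Fin K), s ≠ 0 → s.card ≤ N ^ d →
      ∃ H : Hierarchy K d, H.arms = s ∧ H.BranchingLE N := by
    intro N d hN
    induction d with
    | zero =>
      intro s hs hc
      have h1 : s.card = 1 := le_antisymm (by simpa using hc) (Multiset.card_pos.2 hs)
      obtain ⟨a, rfl⟩ := Multiset.card_eq_one.1 h1
      exact ⟨.arm a, rfl, trivial⟩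
    | succ d ih =>
      have split : ∀ k : ℕ, k ≤ N → ∀ s : Multiset (Fin K), s ≠ 0 → s.card ≤ k * N ^ d →
          ∃ (n : ℕ) (c : Fin (n + 1) → Hierarchy K d), n + 1 ≤ k ∧ ∑ j, (c j).arms = s ∧
            ∀ j, (c j).BranchingLE N := by
        intro k
        induction k with
        | zero => intro _ s hs hc; exact absurd (Multiset.card_eq_zero.1 (by simpa using hc)) hs
        | succ k ihk =>
          intro hk s hs hc
          by_cases hle : s.card ≤ N ^ d
          · obtain ⟨H, h1, h2⟩ := ih s hs hle
            exact ⟨0, fun _ => H, by omega, by simpa using h1, fun _ => h2⟩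
          · push Not at hle
            obtain ⟨u, hu, huc⟩ : ∃ u ≤ s, u.card = N ^ d := by
              induction s using Quotient.inductionOn with
              | h l =>
                refine ⟨(l.take (N ^ d) : List (Fin K)), ?_, ?_⟩
                · exact Multiset.coe_le.2 (List.take_sublist _ _).subperm
                · simpa using hle.le
            obtain ⟨v, rfl⟩ := Multiset.le_iff_exists_add.1 hu
            have hpos : 0 < N ^ d := Nat.pow_pos hN
            rw [Multiset.card_add] at hc hle
            obtain ⟨H, h1, h2⟩ := ih u (Multiset.card_pos.1 (by omega)) huc.le
            obtain ⟨n, c, hn, h3, h4⟩ := ihk (by omega) v (Multiset.card_pos.1 (by omega))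
              (by rw [add_mul] at hc; omega)
            refine ⟨n + 1, Fin.cons H c, by omega, ?_, ?_⟩
            · rw [Fin.sum_univ_succ]; simp [h1, h3]
            · intro j; refine Fin.cases ?_ (fun j => ?_) j
              · simpa using h2
              · simpa using h4 j
      intro s hs hc
      obtain ⟨n, c, h1, h2, h3⟩ := split N le_rfl s hs (by rwa [pow_succ, mul_comm] at hc)
      exact ⟨.group n c, h2, h1, h3⟩
  have hK' : (1 : ℝ) ≤ K := by exact_mod_cast hK
  have hp : (1 : ℝ) ≤ (K : ℝ) ^ (1 / (D : ℝ)) := Real.one_le_rpow hK' (by positivity)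
  refine key _ D (Nat.one_le_iff_ne_zero.2 (Nat.ceil_pos.2 (by linarith)).ne') _ ?_ ?_
  · intro h; have := congrArg Multiset.card h; simp at this; omega
  · have h2 : (K : ℝ) ≤ (branchingNumber K D : ℝ) ^ D :=
      calc (K : ℝ) = ((K : ℝ) ^ (1 / (D : ℝ))) ^ D := by
            rw [one_div, Real.rpow_inv_natCast_pow (by positivity) (by omega)]
        _ ≤ _ := pow_le_pow_left₀ (by positivity) (Nat.le_ceil _) D
    have h3 : K ≤ branchingNumber K D ^ D := by exact_mod_cast h2
    simpa [branchingNumber] using h3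

/-! ## The HLMC policy -/

/-- The record of one play: the arm, the reward received, and the number of words of memory that
are in use at the time of the play. -/
structure Play (K : ℕ) where
  arm : Fin K
  reward : ℝ
  words : ℕ

/-- Cumulative reward of a sequence of plays. -/
def totalReward {K : ℕ} (l : List (Play K)) : ℝ := (l.map Play.reward).sum

/-- Average reward per play of a sequence of plays. -/
def meanReward {K : ℕ} (l : List (Play K)) : ℝ := totalReward l / (l.length : ℝ)

/-- `hlmcEpoch r S γ aux H held t len` is the law of the plays at the times `t, …, t + len - 1` of
an epoch in which the group `H` has been selected. Here `r t a` is the reward of arm `a` at time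
`t`, and `held` is the number of words held by the levels above.

A group with `n + 1` subgroups keeps, until the end of the epoch, one statistic (an EXP3 weight)
for each subgroup and `aux` words of bookkeeping (such as the running average and the counters).
The epoch is divided into subepochs of length `S ^ d`, the last one possibly shorter. A newly
started EXP3 selects a subgroup at the beginning of each subepoch; the selected subgroup is then
run in this subepoch, and its average reward per play is fed back to EXP3. -/
def hlmcEpoch {K : ℕ} (r : ℕ → Fin K → ℝ) (S : ℕ) (γ : unitInterval) (aux : ℕ) :
    {d : ℕ} → Hierarchy K d → (held t len : ℕ) → PMF (List (Play K))
  | 0, .arm a, held, t, _ => PMF.pure [⟨a, r t a, held⟩]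
  | d + 1, .group n child, held, t, len =>
    (exp3 γ
      (fun s j => hlmcEpoch r S γ aux (child j) (held + (n + 1) + aux) (t + s * S ^ d)
        (min (S ^ d) (len - s * S ^ d)))
      meanReward ((len + S ^ d - 1) / S ^ d) 0 (Exp3Weights.init n)).map List.flatten

/-- The number `S` of subepochs of an epoch, at every level. The rule
`S_i = ⌈T^{1/D} (N_i ln N_i)^{(D-1)/D} / (∏_{j ≠ i} N_j ln N_j)^{1/D}⌉` reduces to `⌈T^{1/D}⌉`
when all `N_i` are equal. -/
def epochNumber (D T : ℕ) : ℕ := ⌈(T : ℝ) ^ (1 / (D : ℝ))⌉₊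

/-- The learning rate `√(N ln N / (2 S))`, capped at `1`. -/
def learningRate (N S : ℕ) : unitInterval :=
  ⟨min 1 (Real.sqrt ((N : ℝ) * Real.log N / (2 * (S : ℝ)))),
    le_min zero_le_one (Real.sqrt_nonneg _), min_le_left _ _⟩

/-- The law of the `T` plays (times `0, …, T - 1`) of HLMC on the `D`-level hierarchy `H` with
EXP3 at every level. -/
def hlmc {K D : ℕ} (H : Hierarchy K D) (T : ℕ) (aux : ℕ) (r : ℕ → Fin K → ℝ) :
    PMF (List (Play K)) :=
  hlmcEpoch r (epochNumber D T) (learningRate (branchingNumber K D) (epochNumber D T)) aux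
    H 0 0 T

/-! ## Memory and regret -/

/-- `M` is the memory requirement: the largest number of words in use at a play, over all runs
that have positive probability. -/
def IsMemoryRequirement {K : ℕ} (p : PMF (List (Play K))) (M : ℕ) : Prop :=
  IsGreatest {m : ℕ | ∃ l ∈ p.support, ∃ x ∈ l, x.words = m} M

/-- Weak regret of a sequence of `T` plays: against the best fixed arm in hindsight. -/
def weakRegret {K : ℕ} (r : ℕ → Fin K → ℝ) (T : ℕ) (l : List (Play K)) : ℝ :=
  (⨆ i : Fin K, ∑ t ∈ Finset.range T, r t i) - totalReward l

/-- Expected weak regret. (The laws to which this is applied have finite support, so the sum is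
a finite one.) -/
def expectedWeakRegret {K : ℕ} (r : ℕ → Fin K → ℝ) (T : ℕ) (p : PMF (List (Play K))) : ℝ :=
  ∑' l, (p l).toReal * weakRegret r T l

end

/-!
Memory. A play uses one word for each subgroup of every group on the path from the root to the
played arm, and `aux` words per level. No group has more than `N = ⌈K^{1/D}⌉ ≤ 2 K^{1/D}`
subgroups, hence the upper bound. For the lower bound, the path that always moves to the subgroup
with the most arms passes groups whose numbers of subgroups multiply to at least `K`
(`hlmcEpoch_exists_words_ge`), so their sum is at least `D K^{1/D}` by the inequality of
arithmetic and geometric means; EXP3 follows this path with positive probability.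

Regret. The law of the outcome of a subepoch depends only on its position and on the selected
subgroup, since every EXP3 instance below is newly started. So for the EXP3 instance of one epoch
the rewards are those of an oblivious stochastic adversary, and the potential argument
(`Exp3Weights.potential_update_le`, `exp3_gain_lower_bound`) bounds its regret over at most `S`
steps by `2 γ S + N ln N / γ`. The last subepoch may be shorter than the others, and its average
then has the wrong weight; it is left out of the comparison, at the cost of its length. Descending
from the root to the best arm, each level adds at most `S^{D-1} (2 γ S + N ln N / γ + 1)` to the
regret (`hlmcEpoch_regret_le`). For `γ = √(N ln N / (2 S)) < 1` the sum over the levels is of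
order `D S^{D-1/2} √(N ln N)`; if `γ` is capped at `1`, the trivial bound `T` suffices.

Rounding. `S^D` can exceed `T` by a factor of up to `2^D`. If `T^{1/D} ≥ D`, the factor is at most
`(1 + 1/D)^D ≤ e` (`epochNumber_pow_le`). Otherwise `T = T^{1-1/(2D)} T^{1/(2D)}` is at most
`T^{1-1/(2D)} √D`, and the trivial bound `T` suffices again.
-/

/-! ### Expectations under finitely supported laws -/

/-- The expectation of `f` under `p`. The lemmas below concern laws of finite support, for which
the sum is finite. -/
noncomputable def expect {α : Type*} (p : PMF α) (f : α → ℝ) : ℝ := ∑' a, (p a).toReal * f a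

theorem expect_eq_sum {α : Type*} {p : PMF α} {s : Finset α} (hs : p.support ⊆ s) (f : α → ℝ) :
    expect p f = ∑ a ∈ s, (p a).toReal * f a :=
  tsum_eq_sum fun a ha => by
    have : p a = 0 := by
      by_contra h
      exact ha (hs ((p.mem_support_iff a).2 h))
    simp [this]

theorem PMF.sum_toReal_eq_one {α : Type*} {p : PMF α} {s : Finset α} (hs : p.support ⊆ s) :
    ∑ a ∈ s, (p a).toReal = 1 := by
  rw [← ENNReal.toReal_sum fun a _ => p.apply_ne_top a, ← ENNReal.toReal_one, ← p.tsum_coe,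
    tsum_eq_sum (s := s)]
  intro a ha
  by_contra h
  exact ha (hs ((p.mem_support_iff a).2 h))

theorem expect_pure {α : Type*} (a : α) (f : α → ℝ) : expect (PMF.pure a) f = f a := by
  rw [expect_eq_sum (s := {a}) (by simp)]
  simp

theorem expect_affine {α : Type*} {p : PMF α} (hp : p.support.Finite) (a c : ℝ) (f : α → ℝ) :
    expect p (fun x => a + c * f x) = a + c * expect p f := by
  have hs : p.support ⊆ hp.toFinset := by simp
  rw [expect_eq_sum hs, expect_eq_sum hs, Finset.mul_sum]
  calc _ = ∑ x ∈ hp.toFinset, ((p x).toReal * a + c * ((p x).toReal * f x)) :=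
        Finset.sum_congr rfl fun _ _ => by ring
    _ = _ := by rw [Finset.sum_add_distrib, ← Finset.sum_mul, PMF.sum_toReal_eq_one hs, one_mul]

theorem expect_mono {α : Type*} {p : PMF α} (hp : p.support.Finite) {f g : α → ℝ}
    (h : ∀ a ∈ p.support, f a ≤ g a) : expect p f ≤ expect p g := by
  have hs : p.support ⊆ hp.toFinset := by simp
  rw [expect_eq_sum hs, expect_eq_sum hs]
  exact Finset.sum_le_sum fun a ha =>
    mul_le_mul_of_nonneg_left (h a (hp.mem_toFinset.1 ha)) ENNReal.toReal_nonneg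

theorem expect_congr {α : Type*} {p : PMF α} {f g : α → ℝ}
    (h : ∀ a ∈ p.support, f a = g a) : expect p f = expect p g := by
  refine tsum_congr fun a => ?_
  by_cases ha : a ∈ p.support
  · rw [h a ha]
  · simp [(p.apply_eq_zero_iff a).2 ha]

theorem le_expect {α : Type*} {p : PMF α} (hp : p.support.Finite) {f : α → ℝ} {c : ℝ}
    (h : ∀ a ∈ p.support, c ≤ f a) : c ≤ expect p f := by
  have h1 := expect_affine hp c 0 f
  have h2 : expect p (fun x => c + 0 * f x) ≤ expect p f :=
    expect_mono hp fun a ha => by simpa using h a ha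
  linarith

theorem expect_le {α : Type*} {p : PMF α} (hp : p.support.Finite) {f : α → ℝ} {c : ℝ}
    (h : ∀ a ∈ p.support, f a ≤ c) : expect p f ≤ c := by
  have h1 := expect_affine hp c 0 f
  have h2 : expect p f ≤ expect p (fun x => c + 0 * f x) :=
    expect_mono hp fun a ha => by simpa using h a ha
  linarith

theorem PMF.finite_support_bind {α β : Type*} {p : PMF α} {q : α → PMF β}
    (hp : p.support.Finite) (hq : ∀ a ∈ p.support, (q a).support.Finite) :
    (p.bind q).support.Finite := by
  rw [PMF.support_bind]
  exact hp.biUnion hq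

theorem PMF.finite_support_map {α β : Type*} {p : PMF α} (f : α → β) (hp : p.support.Finite) :
    (p.map f).support.Finite := by
  rw [PMF.support_map]
  exact hp.image f

theorem expect_bind {α β : Type*} {p : PMF α} {q : α → PMF β} (hp : p.support.Finite)
    (hq : ∀ a ∈ p.support, (q a).support.Finite) (f : β → ℝ) :
    expect (p.bind q) f = expect p fun a => expect (q a) f := by
  have hb := PMF.finite_support_bind hp hq
  have hs : p.support ⊆ hp.toFinset := by simp
  have ht : (p.bind q).support ⊆ hb.toFinset := by simp
  have hqt : ∀ a ∈ p.support, (q a).support ⊆ hb.toFinset := fun a ha b h =>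
    ht ((PMF.mem_support_bind_iff p q b).2 ⟨a, ha, h⟩)
  have hval : ∀ b, ((p.bind q) b).toReal = ∑ a ∈ hp.toFinset, (p a).toReal * (q a b).toReal := by
    intro b
    rw [PMF.bind_apply, tsum_eq_sum (s := hp.toFinset), ENNReal.toReal_sum]
    · simp only [ENNReal.toReal_mul]
    · exact fun a _ => ENNReal.mul_ne_top (p.apply_ne_top a) ((q a).apply_ne_top b)
    · intro a ha
      have : p a = 0 := (p.apply_eq_zero_iff a).2 fun h => ha (hs h)
      simp [this]
  rw [expect_eq_sum ht, expect_eq_sum hs]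
  simp only [hval, Finset.sum_mul]
  rw [Finset.sum_comm]
  refine Finset.sum_congr rfl fun a ha => ?_
  rw [expect_eq_sum (hqt a (hp.mem_toFinset.1 ha)), Finset.mul_sum]
  exact Finset.sum_congr rfl fun _ _ => by ring

theorem expect_map {α β : Type*} {p : PMF α} (hp : p.support.Finite) (f : α → β) (g : β → ℝ) :
    expect (p.map f) g = expect p (g ∘ f) := by
  rw [← PMF.bind_pure_comp, expect_bind hp fun a _ => by simp]
  simp only [Function.comp_apply, expect_pure]
  rfl

theorem expect_draw {n : ℕ} (γ : unitInterval) (w : Exp3Weights n) (f : Fin (n + 1) → ℝ) :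
    expect (w.draw γ) f = ∑ j, w.prob γ j * f j := by
  rw [expect_eq_sum (s := Finset.univ) (by simp)]
  refine Finset.sum_congr rfl fun j _ => ?_
  rw [Exp3Weights.draw, PMF.ofFintype_apply, ENNReal.toReal_ofReal (w.prob_nonneg γ j)]

/-! ### The regret of EXP3 -/

theorem exp3_finite_support {n : ℕ} {β : Type} {γ : unitInterval} {pull : ℕ → Fin (n + 1) → PMF β}
    (feedback : β → ℝ) (hfin : ∀ s j, (pull s j).support.Finite) (m : ℕ) :
    ∀ s w, (exp3 γ pull feedback m s w).support.Finite := by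
  induction m with
  | zero => intro s w; simp [exp3]
  | succ m ih =>
    intro s w
    exact PMF.finite_support_bind (Set.toFinite _) fun j _ =>
      PMF.finite_support_bind (hfin s j) fun b _ => PMF.finite_support_map _ (ih _ _)

theorem exp3_support_succ {n : ℕ} {β : Type} {γ : unitInterval} {pull : ℕ → Fin (n + 1) → PMF β}
    {feedback : β → ℝ} {m s : ℕ} {w : Exp3Weights n} {l : List β} :
    l ∈ (exp3 γ pull feedback (m + 1) s w).support ↔
      ∃ j ∈ (w.draw γ).support, ∃ b ∈ (pull s j).support,
        ∃ l' ∈ (exp3 γ pull feedback m (s + 1) (w.update γ j (feedback b))).support,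
          b :: l' = l := by
  simp only [exp3, PMF.mem_support_bind_iff, PMF.support_map, Set.mem_image]

theorem expect_exp3_succ {n : ℕ} {β : Type} {γ : unitInterval} {pull : ℕ → Fin (n + 1) → PMF β}
    {feedback : β → ℝ} (hfin : ∀ s j, (pull s j).support.Finite) (g : β → ℝ) (m s : ℕ)
    (w : Exp3Weights n) :
    expect (exp3 γ pull feedback (m + 1) s w) (fun l => (l.map g).sum) =
      ∑ j, w.prob γ j * expect (pull s j) fun b =>
        g b + expect (exp3 γ pull feedback m (s + 1) (w.update γ j (feedback b)))
          fun l => (l.map g).sum := by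
  have hmap : ∀ j b, ((exp3 γ pull feedback m (s + 1) (w.update γ j (feedback b))).map
      fun l => b :: l).support.Finite := fun j b =>
    PMF.finite_support_map _ (exp3_finite_support feedback hfin m _ _)
  rw [exp3, expect_bind (Set.toFinite _) fun j _ =>
    PMF.finite_support_bind (hfin s j) fun b _ => hmap j b, expect_draw]
  refine Finset.sum_congr rfl fun j _ => ?_
  rw [expect_bind (hfin s j) fun b _ => hmap j b]
  congr 2
  funext b
  have hf := exp3_finite_support (γ := γ) feedback hfin m (s + 1) (w.update γ j (feedback b))
  rw [expect_map hf]
  simpa [Function.comp_def] using expect_affine hf (g b) 1 fun l => (l.map g).sum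

theorem Exp3Weights.sum_pos {n : ℕ} (w : Exp3Weights n) : 0 < ∑ i, w.1 i :=
  Finset.sum_pos (fun j _ => w.2 j) Finset.univ_nonempty

theorem Exp3Weights.le_prob {n : ℕ} (γ : unitInterval) (w : Exp3Weights n) (i : Fin (n + 1)) :
    (γ : ℝ) / ((n : ℝ) + 1) ≤ w.prob γ i := by
  have h1 : (0 : ℝ) ≤ 1 - γ := sub_nonneg.2 γ.2.2
  have h2 : 0 ≤ w.1 i / ∑ j, w.1 j := div_nonneg (w.2 i).le w.sum_pos.le
  unfold Exp3Weights.prob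
  nlinarith [mul_nonneg h1 h2]

theorem Exp3Weights.prob_pos {n : ℕ} (γ : unitInterval) (w : Exp3Weights n) (i : Fin (n + 1)) :
    0 < w.prob γ i := by
  rcases γ.2.1.eq_or_lt with h | h
  · have : 0 < w.1 i / ∑ j, w.1 j := div_pos (w.2 i) w.sum_pos
    simpa [Exp3Weights.prob, ← h] using this
  · exact lt_of_lt_of_le (by positivity) (w.le_prob γ i)

/-- The logarithm of the inverse of the share of arm `k` in the total weight. -/
noncomputable def Exp3Weights.potential {n : ℕ} (w : Exp3Weights n) (k : Fin (n + 1)) : ℝ :=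
  Real.log (∑ i, w.1 i) - Real.log (w.1 k)

theorem Exp3Weights.potential_nonneg {n : ℕ} (w : Exp3Weights n) (k : Fin (n + 1)) :
    0 ≤ w.potential k :=
  sub_nonneg.2 (Real.log_le_log (w.2 k)
    (Finset.single_le_sum (fun i _ => (w.2 i).le) (Finset.mem_univ k)))

theorem Exp3Weights.potential_init {n : ℕ} (k : Fin (n + 1)) :
    (Exp3Weights.init n).potential k = Real.log ((n : ℝ) + 1) := by
  simp [potential, init]

/-- One update raises the logarithm of the total weight by little more than the received reward
`y` accounts for, and the logarithm of the weight of `k` by the importance-weighted estimate of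
its reward. Multiplying by `1 - γ` makes the bound hold at `γ = 1` too. -/
theorem Exp3Weights.potential_update_le {n : ℕ} {γ : unitInterval} (w : Exp3Weights n)
    (j k : Fin (n + 1)) {y : ℝ} (hy : y ∈ Set.Icc (0 : ℝ) 1) :
    (1 - (γ : ℝ)) * (w.update γ j y).potential k ≤ (1 - (γ : ℝ)) * w.potential k +
      (γ / ((n : ℝ) + 1)) * y + (γ / ((n : ℝ) + 1)) ^ 2 * (y / w.prob γ j) -
      (1 - (γ : ℝ)) * (γ / ((n : ℝ) + 1)) * (if k = j then y / w.prob γ j else 0) := by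
  obtain ⟨hy0, hy1⟩ := hy
  have hγ0 : (0 : ℝ) ≤ γ := γ.2.1
  have hγ1 : (0 : ℝ) ≤ 1 - γ := sub_nonneg.2 γ.2.2
  set η : ℝ := γ / ((n : ℝ) + 1) with hη
  have hη0 : 0 ≤ η := by positivity
  set p := w.prob γ j with hp
  have hp0 : 0 < p := w.prob_pos γ j
  have hηp : η ≤ p := w.le_prob γ j
  set W := ∑ i, w.1 i with hW
  have hW0 : 0 < W := w.sum_pos
  set x := η * (y / p) with hx
  have hx0 : 0 ≤ x := by positivity
  have hx1 : x ≤ 1 := by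
    rw [hx, ← mul_div_assoc, div_le_one hp0]
    nlinarith
  have hval : ∀ i, (w.update γ j y).1 i = w.1 i * (if i = j then Real.exp x else 1) := by
    intro i
    by_cases hij : i = j
    · subst hij
      simp only [update, if_true]
      congr 2
      rw [hx, hη]
      ring
    · simp [update, hij]
  -- `w_j / W` is at most `p / (1 - γ)`.
  have hshare : (1 - (γ : ℝ)) * (w.1 j / W) ≤ p := by
    rw [hp, Exp3Weights.prob]
    linarith
  have hsum : ∑ i, (w.update γ j y).1 i = W * (1 + w.1 j / W * (Real.exp x - 1)) := by
    have : ∀ i, (w.update γ j y).1 i = w.1 i + if i = j then w.1 i * (Real.exp x - 1) else 0 := by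
      intro i
      rw [hval]
      split_ifs <;> ring
    simp only [this, Finset.sum_add_distrib, Finset.sum_ite_eq', Finset.mem_univ, if_true]
    rw [← hW]
    field_simp
  have hexp : Real.exp x - 1 ≤ x + x ^ 2 := by
    have := (abs_le.1 (Real.abs_exp_sub_one_sub_id_le (x := x) (by rwa [abs_of_nonneg hx0]))).2
    linarith
  have hexp0 : 0 ≤ Real.exp x - 1 := by linarith [Real.add_one_le_exp x]
  have hq0 : 0 ≤ w.1 j / W := div_nonneg (w.2 j).le hW0.le
  have hlogW : Real.log (∑ i, (w.update γ j y).1 i) ≤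
      Real.log W + w.1 j / W * (x + x ^ 2) := by
    rw [hsum, Real.log_mul hW0.ne' (by positivity)]
    have h1 := Real.log_le_sub_one_of_pos (x := 1 + w.1 j / W * (Real.exp x - 1)) (by positivity)
    have h2 := mul_le_mul_of_nonneg_left hexp hq0
    linarith
  have hlogk : Real.log ((w.update γ j y).1 k) = Real.log (w.1 k) +
      η * if k = j then y / p else 0 := by
    rw [hval]
    split_ifs
    · rw [Real.log_mul (w.2 k).ne' (Real.exp_pos x).ne', Real.log_exp]
    · simp
  have hmain : (1 - (γ : ℝ)) * (w.1 j / W * (x + x ^ 2)) ≤ η * y + η ^ 2 * (y / p) := by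
    calc (1 - (γ : ℝ)) * (w.1 j / W * (x + x ^ 2)) = (1 - (γ : ℝ)) * (w.1 j / W) * (x + x ^ 2) := by
          ring
      _ ≤ p * (x + x ^ 2) := mul_le_mul_of_nonneg_right hshare (by positivity)
      _ = η * y + η ^ 2 * (y / p) * y := by rw [hx]; field_simp
      _ ≤ η * y + η ^ 2 * (y / p) := by
          have : η ^ 2 * (y / p) * y ≤ η ^ 2 * (y / p) :=
            mul_le_of_le_one_right (by positivity) hy1
          linarith
  have h3 := mul_le_mul_of_nonneg_left hlogW hγ1
  unfold potential
  rw [hlogk]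
  linarith

/-- EXP3 against arm `k` over the first `m` of `m + q` steps. The gain `g` has to agree with the
feedback in those steps only, and to be nonnegative throughout. -/
theorem exp3_gain_lower_bound {n : ℕ} {β : Type} {γ : unitInterval}
    {pull : ℕ → Fin (n + 1) → PMF β} {feedback g : β → ℝ}
    (hfin : ∀ s j, (pull s j).support.Finite)
    (hfb : ∀ s j, ∀ b ∈ (pull s j).support, feedback b ∈ Set.Icc (0 : ℝ) 1)
    (hg : ∀ s j, ∀ b ∈ (pull s j).support, 0 ≤ g b) (k : Fin (n + 1)) (q m : ℕ) :
    ∀ (s : ℕ) (w : Exp3Weights n),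
      (∀ i < m, ∀ j, ∀ b ∈ (pull (s + i) j).support, g b = feedback b) →
      (1 - (γ : ℝ)) * (γ / ((n : ℝ) + 1)) *
          ∑ i ∈ Finset.range m, expect (pull (s + i) k) feedback ≤
        (γ / ((n : ℝ) + 1)) *
          expect (exp3 γ pull feedback (m + q) s w) (fun l => (l.map g).sum) +
        (1 - (γ : ℝ)) * w.potential k + (γ / ((n : ℝ) + 1)) * γ * m := by
  have hγ0 : (0 : ℝ) ≤ γ := γ.2.1
  have hγ1 : (0 : ℝ) ≤ 1 - γ := sub_nonneg.2 γ.2.2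
  set η : ℝ := γ / ((n : ℝ) + 1) with hη
  have hη0 : 0 ≤ η := by positivity
  have hηn : η * ((n : ℝ) + 1) = γ := by rw [hη]; field_simp
  induction m with
  | zero =>
    intro s w _
    have hpos : ∀ (q s : ℕ) (w : Exp3Weights n),
        0 ≤ expect (exp3 γ pull feedback q s w) fun l => (l.map g).sum := by
      intro q
      induction q with
      | zero => intro s w; simp [exp3, expect_pure]
      | succ q ih =>
        intro s w
        rw [expect_exp3_succ hfin]
        exact Finset.sum_nonneg fun j _ => mul_nonneg (w.prob_nonneg γ j)
          (le_expect (hfin s j) fun b hb => add_nonneg (hg s j b hb) (ih _ _))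
    have h1 := mul_nonneg hη0 (hpos (0 + q) s w)
    have h2 := mul_nonneg hγ1 (w.potential_nonneg k)
    simp only [Finset.range_zero, Finset.sum_empty, mul_zero, Nat.cast_zero, add_zero]
    linarith
  | succ m ih =>
    intro s w hgf
    set A := ∑ i ∈ Finset.range m, expect (pull (s + 1 + i) k) feedback with hA
    have hsum : ∑ i ∈ Finset.range (m + 1), expect (pull (s + i) k) feedback =
        A + expect (pull s k) feedback := by
      rw [Finset.sum_range_succ', hA]
      simp only [add_zero]
      congr 1
      exact Finset.sum_congr rfl fun i _ => by rw [show s + (i + 1) = s + 1 + i by ring]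
    set c := (1 - (γ : ℝ)) * η * A - (1 - (γ : ℝ)) * w.potential k - η * γ * m with hc
    have hμ : ∀ j, expect (pull s j) feedback ≤ 1 := fun j =>
      expect_le (hfin s j) fun b hb => (hfb s j b hb).2
    have hstep : ∀ j, c + ((1 - (γ : ℝ)) * η * (if k = j then 1 / w.prob γ j else 0) -
          η ^ 2 / w.prob γ j) * expect (pull s j) feedback ≤
        η * expect (pull s j) fun b => g b +
          expect (exp3 γ pull feedback (m + q) (s + 1) (w.update γ j (feedback b)))
            fun l => (l.map g).sum := by
      intro j
      have h0 := expect_affine (hfin s j) 0 η fun b => g b +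
          expect (exp3 γ pull feedback (m + q) (s + 1) (w.update γ j (feedback b)))
            fun l => (l.map g).sum
      rw [zero_add] at h0
      rw [← expect_affine (hfin s j), ← h0]
      refine expect_mono (hfin s j) fun b hb => ?_
      have h1 := ih (s + 1) (w.update γ j (feedback b)) fun i hi j' b' hb' =>
        hgf (i + 1) (by omega) j' b' (by rwa [show s + (i + 1) = s + 1 + i by ring])
      have h2 := w.potential_update_le (γ := γ) j k (hfb s j b hb)
      have h3 : g b = feedback b := hgf 0 (by omega) j b (by simpa using hb)
      rw [← hη] at h2
      rw [← hA] at h1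
      have h4 : (if k = j then feedback b / w.prob γ j else 0) =
          (if k = j then 1 / w.prob γ j else 0) * feedback b := by
        split_ifs <;> ring
      rw [h4] at h2
      rw [h3, hc]
      have h5 : η ^ 2 * (feedback b / w.prob γ j) = η ^ 2 / w.prob γ j * feedback b := by ring
      rw [h5] at h2
      linarith
    rw [hsum, show m + 1 + q = m + q + 1 by ring, expect_exp3_succ hfin, Finset.mul_sum]
    have hbound : ∑ j, w.prob γ j * (c + ((1 - (γ : ℝ)) * η *
          (if k = j then 1 / w.prob γ j else 0) - η ^ 2 / w.prob γ j) *
            expect (pull s j) feedback) ≤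
        ∑ j, η * (w.prob γ j * expect (pull s j) fun b => g b +
          expect (exp3 γ pull feedback (m + q) (s + 1) (w.update γ j (feedback b)))
            fun l => (l.map g).sum) := by
      refine Finset.sum_le_sum fun j _ => ?_
      have := mul_le_mul_of_nonneg_left (hstep j) (w.prob_nonneg γ j)
      linarith
    have hlhs : ∑ j, w.prob γ j * (c + ((1 - (γ : ℝ)) * η *
          (if k = j then 1 / w.prob γ j else 0) - η ^ 2 / w.prob γ j) *
            expect (pull s j) feedback) =
        c + (1 - (γ : ℝ)) * η * expect (pull s k) feedback -
          η ^ 2 * ∑ j, expect (pull s j) feedback := by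
      have : ∀ j, w.prob γ j * (c + ((1 - (γ : ℝ)) * η *
          (if k = j then 1 / w.prob γ j else 0) - η ^ 2 / w.prob γ j) *
            expect (pull s j) feedback) = w.prob γ j * c +
          (if k = j then (1 - (γ : ℝ)) * η * expect (pull s j) feedback else 0) -
          η ^ 2 * expect (pull s j) feedback := by
        intro j
        have := (w.prob_pos γ j).ne'
        split_ifs <;> field_simp <;> ring
      simp only [this, Finset.sum_sub_distrib, Finset.sum_add_distrib, Finset.sum_ite_eq,
        Finset.mem_univ, if_true, ← Finset.sum_mul, w.sum_prob γ, ← Finset.mul_sum, one_mul]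
    have hμsum : ∑ j, expect (pull s j) feedback ≤ (n : ℝ) + 1 :=
      (Finset.sum_le_sum fun j _ => hμ j).trans (by simp)
    have h6 : η ^ 2 * ∑ j, expect (pull s j) feedback ≤ η * γ := by
      calc _ ≤ η ^ 2 * ((n : ℝ) + 1) := mul_le_mul_of_nonneg_left hμsum (by positivity)
        _ = η * γ := by rw [← hηn]; ring
    push_cast
    linarith

/-- The regret bound of EXP3 over the first `m` of `m + q` steps, with the gain as in
`exp3_gain_lower_bound`. -/
theorem exp3_regret_le {n : ℕ} {β : Type} {γ : unitInterval} (hγ : 0 < (γ : ℝ))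
    {pull : ℕ → Fin (n + 1) → PMF β} {feedback g : β → ℝ}
    (hfin : ∀ s j, (pull s j).support.Finite)
    (hfb : ∀ s j, ∀ b ∈ (pull s j).support, feedback b ∈ Set.Icc (0 : ℝ) 1)
    (hg : ∀ s j, ∀ b ∈ (pull s j).support, 0 ≤ g b) (k : Fin (n + 1)) (q m : ℕ)
    (hgf : ∀ i < m, ∀ j, ∀ b ∈ (pull i j).support, g b = feedback b) :
    ∑ i ∈ Finset.range m, expect (pull i k) feedback -
        expect (exp3 γ pull feedback (m + q) 0 (Exp3Weights.init n)) (fun l => (l.map g).sum) ≤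
      2 * γ * m + ((n : ℝ) + 1) * Real.log ((n : ℝ) + 1) / γ := by
  have h := exp3_gain_lower_bound (γ := γ) hfin hfb hg k q m 0 (Exp3Weights.init n)
    (by simpa using hgf)
  rw [Exp3Weights.potential_init] at h
  simp only [zero_add] at h
  have hγ1 : (γ : ℝ) ≤ 1 := γ.2.2
  have hμ : ∑ i ∈ Finset.range m, expect (pull i k) feedback ≤ m :=
    (Finset.sum_le_sum fun i _ => expect_le (hfin i k) fun b hb => (hfb i k b hb).2).trans
      (by simp)
  set A := ∑ i ∈ Finset.range m, expect (pull i k) feedback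
  set G := expect (exp3 γ pull feedback (m + q) 0 (Exp3Weights.init n)) fun l => (l.map g).sum
  set lg := Real.log ((n : ℝ) + 1) with hlg
  have hlg0 : 0 ≤ lg := Real.log_nonneg (by linarith [Nat.cast_nonneg (α := ℝ) n])
  have hη : 0 < (γ : ℝ) / ((n : ℝ) + 1) := by positivity
  have h1 : (γ : ℝ) / ((n : ℝ) + 1) * (((n : ℝ) + 1) * lg / γ) = lg := by field_simp
  have h2 : (γ : ℝ) * A ≤ γ * m := mul_le_mul_of_nonneg_left hμ hγ.le
  have h3 : (1 - (γ : ℝ)) * lg ≤ lg := by nlinarith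
  refine le_of_mul_le_mul_left ?_ hη
  nlinarith [mul_le_mul_of_nonneg_left h2 hη.le]

/-! ### The plays of an epoch -/

theorem exp3_support_mem {n : ℕ} {β : Type} {γ : unitInterval} {pull : ℕ → Fin (n + 1) → PMF β}
    {feedback : β → ℝ} {m : ℕ} :
    ∀ {s : ℕ} {w : Exp3Weights n} {l : List β}, l ∈ (exp3 γ pull feedback m s w).support →
      ∀ b ∈ l, ∃ i < m, ∃ j, b ∈ (pull (s + i) j).support := by
  induction m with
  | zero =>
    intro s w l hl b hb
    simp only [exp3, PMF.support_pure, Set.mem_singleton_iff] at hl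
    simp [hl] at hb
  | succ m ih =>
    intro s w l hl b hb
    obtain ⟨j, _, b₀, hb₀, l', hl', rfl⟩ := exp3_support_succ.1 hl
    rcases List.mem_cons.1 hb with rfl | hb
    · exact ⟨0, by omega, j, hb₀⟩
    · obtain ⟨i, hi, j', h⟩ := ih hl' b hb
      exact ⟨i + 1, by omega, j', by rwa [show s + (i + 1) = s + 1 + i by ring]⟩

theorem exp3_support_length_flatten {n : ℕ} {α : Type} {γ : unitInterval}
    {pull : ℕ → Fin (n + 1) → PMF (List α)} {feedback : List α → ℝ} {c : ℕ → ℕ} {m : ℕ} :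
    ∀ {s : ℕ} {w : Exp3Weights n} {l : List (List α)},
      (∀ i < m, ∀ j, ∀ b ∈ (pull (s + i) j).support, b.length = c (s + i)) →
      l ∈ (exp3 γ pull feedback m s w).support →
      l.flatten.length = ∑ i ∈ Finset.range m, c (s + i) := by
  induction m with
  | zero =>
    intro s w l _ hl
    simp only [exp3, PMF.support_pure, Set.mem_singleton_iff] at hl
    simp [hl]
  | succ m ih =>
    intro s w l hc hl
    obtain ⟨j, _, b, hb, l', hl', rfl⟩ := exp3_support_succ.1 hl
    have h1 := ih (s := s + 1) (fun i hi j b hb => by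
      have := hc (i + 1) (by omega) j b (by rwa [show s + (i + 1) = s + 1 + i by ring])
      rwa [show s + (i + 1) = s + 1 + i by ring] at this) hl'
    have h2 := hc 0 (by omega) j b (by simpa using hb)
    rw [Finset.sum_range_succ', List.flatten_cons, List.length_append, h1, h2, add_comm]
    congr 1
    exact Finset.sum_congr rfl fun i _ => by rw [show s + (i + 1) = s + 1 + i by ring]

theorem hlmcEpoch_finite_support {K : ℕ} (r : ℕ → Fin K → ℝ) (S : ℕ) (γ : unitInterval)
    (aux : ℕ) {d : ℕ} (H : Hierarchy K d) :
    ∀ held t len, (hlmcEpoch r S γ aux H held t len).support.Finite := by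
  induction H with
  | arm a => intro held t len; simp [hlmcEpoch]
  | group n child ih =>
    intro held t len
    exact PMF.finite_support_map _ (exp3_finite_support _ (fun s j => ih j _ _ _) _ _ _)

theorem exists_mem_of_mem_hlmcEpoch_group {K : ℕ} {r : ℕ → Fin K → ℝ} {S : ℕ} {γ : unitInterval}
    {aux d n : ℕ} {child : Fin (n + 1) → Hierarchy K d} {held t len : ℕ} {l : List (Play K)}
    (hl : l ∈ (hlmcEpoch r S γ aux (.group n child) held t len).support) {x : Play K}
    (hx : x ∈ l) :
    ∃ j t' len', ∃ b ∈ (hlmcEpoch r S γ aux (child j) (held + (n + 1) + aux) t' len').support,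
      x ∈ b := by
  rw [hlmcEpoch, PMF.support_map] at hl
  obtain ⟨l', hl', rfl⟩ := hl
  obtain ⟨b, hb, hxb⟩ := List.mem_flatten.1 hx
  obtain ⟨i, _, j, h⟩ := exp3_support_mem hl' b hb
  exact ⟨j, _, _, b, h, hxb⟩

theorem hlmcEpoch_reward_mem {K : ℕ} {r : ℕ → Fin K → ℝ}
    (hr : ∀ t i, r t i ∈ Set.Icc (0 : ℝ) 1) (S : ℕ) (γ : unitInterval) (aux : ℕ) {d : ℕ}
    (H : Hierarchy K d) : ∀ held t len, ∀ l ∈ (hlmcEpoch r S γ aux H held t len).support,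
      ∀ x ∈ l, x.reward ∈ Set.Icc (0 : ℝ) 1 := by
  induction H with
  | arm a =>
    intro held t len l hl x hx
    simp only [hlmcEpoch, PMF.support_pure, Set.mem_singleton_iff] at hl
    subst hl
    rw [List.mem_singleton.1 hx]
    exact hr t a
  | group n child ih =>
    intro held t len l hl x hx
    obtain ⟨j, t', len', b, hb, hxb⟩ := exists_mem_of_mem_hlmcEpoch_group hl hx
    exact ih j _ _ _ b hb x hxb

theorem totalReward_nonneg {K : ℕ} {l : List (Play K)}
    (h : ∀ x ∈ l, x.reward ∈ Set.Icc (0 : ℝ) 1) : 0 ≤ totalReward l :=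
  List.sum_nonneg fun y hy => by
    obtain ⟨x, hx, rfl⟩ := List.mem_map.1 hy
    exact (h x hx).1

theorem totalReward_le_length {K : ℕ} {l : List (Play K)}
    (h : ∀ x ∈ l, x.reward ∈ Set.Icc (0 : ℝ) 1) : totalReward l ≤ l.length := by
  have := List.sum_le_card_nsmul (l.map Play.reward) 1 fun y hy => by
    obtain ⟨x, hx, rfl⟩ := List.mem_map.1 hy
    exact (h x hx).2
  simpa [totalReward] using this

theorem meanReward_mem {K : ℕ} {l : List (Play K)}
    (h : ∀ x ∈ l, x.reward ∈ Set.Icc (0 : ℝ) 1) : meanReward l ∈ Set.Icc (0 : ℝ) 1 :=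
  ⟨div_nonneg (totalReward_nonneg h) (Nat.cast_nonneg _),
    div_le_one_of_le₀ (totalReward_le_length h) (Nat.cast_nonneg _)⟩

theorem totalReward_flatten {K : ℕ} (l : List (List (Play K))) :
    totalReward l.flatten = (l.map totalReward).sum := by
  induction l with
  | nil => simp [totalReward]
  | cons b l ih =>
    rw [List.flatten_cons, List.map_cons, List.sum_cons, ← ih]
    simp [totalReward]

theorem sum_range_min_sub {L : ℕ} :
    ∀ m len : ℕ, m * L < len → len ≤ (m + 1) * L →
      ∑ i ∈ Finset.range (m + 1), min L (len - i * L) = len := by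
  have full : ∀ m len : ℕ, m * L ≤ len →
      ∑ i ∈ Finset.range m, min L (len - i * L) = m * L := by
    intro m len
    induction m with
    | zero => simp
    | succ m ih =>
      intro h
      rw [add_mul, one_mul] at h
      rw [Finset.sum_range_succ, ih (by omega), min_eq_left (by omega), add_mul, one_mul]
  intro m len h1 h2
  rw [add_mul, one_mul] at h2
  rw [Finset.sum_range_succ, full m len h1.le, min_eq_right (by omega)]
  omega

/-- The number of subepochs is one plus the number of those that are surely of full length. -/
theorem subepochs_eq {L len : ℕ} (hL : 1 ≤ L) (hlen : 1 ≤ len) :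
    (len + L - 1) / L = (len - 1) / L + 1 := by
  rw [show len + L - 1 = (len - 1) + L by omega, Nat.add_div_right _ hL]

theorem full_subepochs_bounds {L len : ℕ} (hL : 1 ≤ L) (hlen : 1 ≤ len) :
    (len - 1) / L * L < len ∧ len ≤ ((len - 1) / L + 1) * L := by
  have h1 := Nat.div_mul_le_self (len - 1) L
  have h2 := Nat.lt_div_mul_add (a := len - 1) (b := L) hL
  rw [add_mul, one_mul]
  omega

theorem hlmcEpoch_length {K : ℕ} {r : ℕ → Fin K → ℝ} {S : ℕ} (hS : 1 ≤ S) (γ : unitInterval)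
    (aux : ℕ) {d : ℕ} (H : Hierarchy K d) :
    ∀ held t len, 1 ≤ len → len ≤ S ^ d →
      ∀ l ∈ (hlmcEpoch r S γ aux H held t len).support, l.length = len := by
  induction H with
  | arm a =>
    intro held t len h1 h2 l hl
    simp only [hlmcEpoch, PMF.support_pure, Set.mem_singleton_iff] at hl
    subst hl
    simp only [List.length_singleton]
    rw [pow_zero] at h2
    omega
  | @group d n child ih =>
    intro held t len h1 h2 l hl
    have hL : 1 ≤ S ^ d := Nat.one_le_pow _ _ hS
    rw [hlmcEpoch, PMF.support_map, subepochs_eq hL h1] at hl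
    obtain ⟨l', hl', rfl⟩ := hl
    obtain ⟨h3, h4⟩ := full_subepochs_bounds hL h1
    rw [exp3_support_length_flatten (c := fun i => min (S ^ d) (len - i * S ^ d)) _ hl']
    · simp only [zero_add]
      exact sum_range_min_sub _ _ h3 h4
    · intro i hi j b hb
      have h5 : i * S ^ d ≤ (len - 1) / S ^ d * S ^ d := Nat.mul_le_mul_right _ (by omega)
      rw [zero_add] at hb ⊢
      exact ih j _ _ _ (le_min hL (by omega)) (min_le_left _ _) b hb

/-! ### The regret of an epoch -/

theorem sum_range_mul_blocks (f : ℕ → ℝ) (L m : ℕ) :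
    ∑ i ∈ Finset.range (m * L), f i =
      ∑ i ∈ Finset.range m, ∑ u ∈ Finset.range L, f (i * L + u) := by
  induction m with
  | zero => simp
  | succ m ih => rw [add_mul, one_mul, Finset.sum_range_add, ih, Finset.sum_range_succ]

/-- The expected regret of an epoch against an arm of its group, multiplied by `S`. Descending
towards the arm, each of the `d` levels adds at most `S ^ (d - 1)` times the regret of EXP3 over
`S` steps plus one, where the one stands for the last subepoch, which may be too short for its
average to have full weight. -/
theorem hlmcEpoch_regret_le {K : ℕ} {r : ℕ → Fin K → ℝ}
    (hr : ∀ t i, r t i ∈ Set.Icc (0 : ℝ) 1) {S N : ℕ} (hS : 1 ≤ S) {γ : unitInterval}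
    (hγ : 0 < (γ : ℝ)) (aux : ℕ) {d : ℕ} (H : Hierarchy K d) :
    H.BranchingLE N → ∀ a ∈ H.arms, ∀ held t len, 1 ≤ len → len ≤ S ^ d →
      S * (∑ i ∈ Finset.range len, r (t + i) a -
          expect (hlmcEpoch r S γ aux H held t len) totalReward) ≤
        d * (S : ℝ) ^ d * (2 * γ * S + N * Real.log N / γ + 1) := by
  induction H with
  | arm a' =>
    intro _ a ha held t len h1 h2
    have hlen : len = 1 := by rw [pow_zero] at h2; omega
    have haa : a = a' := by simpa [Hierarchy.arms] using ha
    subst hlen haa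
    simp [hlmcEpoch, expect_pure, totalReward]
  | @group d n child ih =>
    intro hbr a ha held t len h1 h2
    obtain ⟨hnN, hbr⟩ := hbr
    obtain ⟨k, -, hk⟩ := Multiset.mem_sum.1 ha
    have hL : 1 ≤ S ^ d := Nat.one_le_pow _ _ hS
    obtain ⟨h3, h4⟩ := full_subepochs_bounds hL h1
    rw [hlmcEpoch, subepochs_eq hL h1]
    set m := (len - 1) / S ^ d with hm
    have hmS : m ≤ S := by
      have : m * S ^ d < S * S ^ d := lt_of_lt_of_le h3 (by rwa [pow_succ'] at h2)
      exact (Nat.lt_of_mul_lt_mul_right this).le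
    set pull : ℕ → Fin (n + 1) → PMF (List (Play K)) := fun s j =>
      hlmcEpoch r S γ aux (child j) (held + (n + 1) + aux) (t + s * S ^ d)
        (min (S ^ d) (len - s * S ^ d)) with hpull
    have hfin : ∀ s j, (pull s j).support.Finite := fun s j =>
      hlmcEpoch_finite_support _ _ _ _ _ _ _ _
    have hrew : ∀ s j, ∀ b ∈ (pull s j).support, ∀ x ∈ b, x.reward ∈ Set.Icc (0 : ℝ) 1 :=
      fun s j => hlmcEpoch_reward_mem hr _ _ _ _ _ _ _
    have hfull : ∀ i < m, min (S ^ d) (len - i * S ^ d) = S ^ d := by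
      intro i hi
      have h5 : (i + 1) * S ^ d ≤ m * S ^ d := Nat.mul_le_mul_right _ hi
      rw [add_mul, one_mul] at h5
      exact min_eq_left (by omega)
    have hlength : ∀ i < m, ∀ j, ∀ b ∈ (pull i j).support, b.length = S ^ d := by
      intro i hi j b hb
      rw [hpull] at hb
      simp only [hfull i hi] at hb
      exact hlmcEpoch_length hS γ aux (child j) _ _ _ hL le_rfl b hb
    set L : ℝ := (S : ℝ) ^ d with hLdef
    have hLcast : ((S ^ d : ℕ) : ℝ) = L := by rw [hLdef]; push_cast; rfl
    have hS0 : (1 : ℝ) ≤ S := by exact_mod_cast hS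
    have hL0 : 0 < L := by positivity
    have hgf : ∀ i < m, ∀ j, ∀ b ∈ (pull i j).support, totalReward b / L = meanReward b := by
      intro i hi j b hb
      rw [meanReward, hlength i hi j b hb, hLcast]
    -- The regret of EXP3, in units of full subepochs.
    have hexp := exp3_regret_le hγ (feedback := meanReward) (g := fun b => totalReward b / L) hfin
      (fun s j b hb => meanReward_mem (hrew s j b hb))
      (fun s j b hb => div_nonneg (totalReward_nonneg (hrew s j b hb)) hL0.le) k 1 m hgf
    have hgain : expect ((exp3 γ pull meanReward (m + 1) 0 (Exp3Weights.init n)).map List.flatten)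
        totalReward = L * expect (exp3 γ pull meanReward (m + 1) 0 (Exp3Weights.init n))
          fun l => (l.map fun b => totalReward b / L).sum := by
      have hf := exp3_finite_support (γ := γ) meanReward hfin (m + 1) 0 (Exp3Weights.init n)
      rw [expect_map hf, ← zero_add (L * _), ← expect_affine hf]
      congr 1
      funext l
      simp only [Function.comp, totalReward_flatten, div_eq_mul_inv, List.sum_map_mul_right]
      field_simp
      simp
    -- The regret of the subgroup containing `a` within each full subepoch.
    have hinner : ∀ i < m, S * (∑ u ∈ Finset.range (S ^ d), r (t + (i * S ^ d + u)) a -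
        L * expect (pull i k) meanReward) ≤
          d * L * (2 * γ * S + N * Real.log N / γ + 1) := by
      intro i hi
      have h5 := ih k (hbr k) a hk (held + (n + 1) + aux) (t + i * S ^ d) (S ^ d) hL le_rfl
      have h6 : L * expect (pull i k) meanReward = expect (pull i k) totalReward := by
        rw [← zero_add (L * _), ← expect_affine (hfin i k)]
        refine expect_congr fun b hb => ?_
        rw [← hgf i hi k b hb]
        field_simp
        simp
      rw [h6, hpull]
      simp only [hfull i hi]
      simpa only [add_assoc] using h5
    -- The comparison arm in the last subepoch.
    have hrest : ∑ i ∈ Finset.range len, r (t + i) a ≤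
        ∑ i ∈ Finset.range m, ∑ u ∈ Finset.range (S ^ d), r (t + (i * S ^ d + u)) a + L := by
      obtain ⟨e, he⟩ := Nat.exists_eq_add_of_le h3.le
      have heL : (e : ℝ) ≤ L := by
        rw [← hLcast]
        rw [add_mul, one_mul] at h4
        exact_mod_cast (by omega : e ≤ S ^ d)
      rw [he, Finset.sum_range_add, sum_range_mul_blocks fun i => r (t + i) a]
      have : ∑ i ∈ Finset.range e, r (t + (m * S ^ d + i)) a ≤ e :=
        (Finset.sum_le_sum fun i _ => (hr _ a).2).trans (by simp)
      linarith
    have hsumin := Finset.sum_le_sum fun i hi => hinner i (Finset.mem_range.1 hi)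
    rw [← Finset.mul_sum, Finset.sum_sub_distrib, ← Finset.mul_sum, Finset.sum_const,
      Finset.card_range, nsmul_eq_mul] at hsumin
    rw [hgain]
    set X := ∑ i ∈ Finset.range m, ∑ u ∈ Finset.range (S ^ d), r (t + (i * S ^ d + u)) a
    set Y := ∑ i ∈ Finset.range m, expect (pull i k) meanReward
    set G := expect (exp3 γ pull meanReward (m + 1) 0 (Exp3Weights.init n))
          fun l => (l.map fun b => totalReward b / L).sum
    set Z := ∑ i ∈ Finset.range len, r (t + i) a
    have hN0 : (0 : ℝ) < (n : ℝ) + 1 := by positivity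
    have hN1 : (n : ℝ) + 1 ≤ N := by exact_mod_cast hnN
    have hmS' : (m : ℝ) ≤ S := by exact_mod_cast hmS
    have hlog : 0 ≤ Real.log N := Real.log_natCast_nonneg N
    have hlogn : 0 ≤ Real.log ((n : ℝ) + 1) := by exact_mod_cast Real.log_natCast_nonneg (n + 1)
    have hB1 : 2 * (γ : ℝ) * m + ((n : ℝ) + 1) * Real.log ((n : ℝ) + 1) / γ ≤
        2 * γ * S + N * Real.log N / γ := by gcongr
    set B := 2 * (γ : ℝ) * S + N * Real.log N / γ with hB
    have hB0 : 0 ≤ B := by positivity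
    have h7 : (m : ℝ) * (d * L * (B + 1)) ≤ S * (d * L * (B + 1)) :=
      mul_le_mul_of_nonneg_right hmS' (by positivity)
    have h8 : (S : ℝ) * L * (Y - G) ≤ S * L * B :=
      mul_le_mul_of_nonneg_left (hexp.trans hB1) (by positivity)
    have h9 : (S : ℝ) * Z ≤ S * (X + L) := mul_le_mul_of_nonneg_left hrest (by positivity)
    have h10 : (S : ℝ) ^ (d + 1) = S * L := by rw [hLdef]; ring
    rw [h10]
    push_cast
    linarith

/-! ### Memory -/

theorem hlmcEpoch_words_le {K : ℕ} {r : ℕ → Fin K → ℝ} {S N : ℕ} {γ : unitInterval} {aux d : ℕ}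
    (H : Hierarchy K d) : H.BranchingLE N → ∀ held t len,
      ∀ l ∈ (hlmcEpoch r S γ aux H held t len).support, ∀ x ∈ l,
        x.words ≤ held + d * (N + aux) := by
  induction H with
  | arm a =>
    intro _ held t len l hl x hx
    simp only [hlmcEpoch, PMF.support_pure, Set.mem_singleton_iff] at hl
    subst hl
    rw [List.mem_singleton.1 hx]
    simp
  | @group d n child ih =>
    intro hbr held t len l hl x hx
    obtain ⟨j, t', len', b, hb, hxb⟩ := exists_mem_of_mem_hlmcEpoch_group hl hx
    have h1 := ih j (hbr.2 j) _ _ _ b hb x hxb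
    have h2 : n + 1 ≤ N := hbr.1
    rw [add_mul, one_mul]
    omega

theorem Exp3Weights.mem_support_draw {n : ℕ} (γ : unitInterval) (w : Exp3Weights n)
    (j : Fin (n + 1)) : j ∈ (w.draw γ).support := by
  rw [PMF.mem_support_iff, Exp3Weights.draw, PMF.ofFintype_apply]
  exact (ENNReal.ofReal_pos.2 (w.prob_pos γ j)).ne'

/-- Always moving to the subgroup with the most arms leads to an arm along groups whose numbers
of subgroups have a product of at least the number of arms. EXP3 makes every such choice with
positive probability, so the first play can be of that arm. -/
theorem hlmcEpoch_exists_words_ge {K : ℕ} {r : ℕ → Fin K → ℝ} {S : ℕ} (hS : 1 ≤ S)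
    {γ : unitInterval} {aux d : ℕ} (H : Hierarchy K d) :
    ∀ held t len, 1 ≤ len → ∃ l ∈ (hlmcEpoch r S γ aux H held t len).support, ∃ x ∈ l,
      ∃ b : Fin d → ℕ, H.arms.card ≤ ∏ i, b i ∧ held + ∑ i, b i ≤ x.words := by
  induction H with
  | arm a =>
    intro held t len _
    exact ⟨[⟨a, r t a, held⟩], by simp [hlmcEpoch], _, List.mem_singleton_self _, Fin.elim0, by
      simp [Hierarchy.arms], by simp⟩
  | @group d n child ih =>
    intro held t len h1
    have hL : 1 ≤ S ^ d := Nat.one_le_pow _ _ hS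
    obtain ⟨j, -, hj⟩ := Finset.exists_max_image Finset.univ
      (fun j => (child j).arms.card) Finset.univ_nonempty
    obtain ⟨l, hl, x, hx, b, hb1, hb2⟩ := ih j (held + (n + 1) + aux) (t + 0 * S ^ d)
      (min (S ^ d) (len - 0 * S ^ d)) (le_min hL (by omega))
    rw [hlmcEpoch, PMF.support_map, subepochs_eq hL h1]
    obtain ⟨l', hl'⟩ := (exp3 γ
      (fun s j => hlmcEpoch r S γ aux (child j) (held + (n + 1) + aux) (t + s * S ^ d)
        (min (S ^ d) (len - s * S ^ d))) meanReward ((len - 1) / S ^ d) (0 + 1)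
      ((Exp3Weights.init n).update γ j (meanReward l))).support_nonempty
    refine ⟨_, ⟨l :: l', exp3_support_succ.2 ⟨j, Exp3Weights.mem_support_draw _ _ _, l, hl, l', hl',
      rfl⟩, rfl⟩, x, ?_, Fin.cons (n + 1) b, ?_, ?_⟩
    · simp [hx]
    · rw [Fin.prod_univ_succ]
      simp only [Fin.cons_zero, Fin.cons_succ]
      calc (Hierarchy.group n child).arms.card = ∑ i, (child i).arms.card := by
            simp [Hierarchy.arms]
        _ ≤ ∑ _i : Fin (n + 1), (child j).arms.card := Finset.sum_le_sum fun i hi => hj i hi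
        _ = (n + 1) * (child j).arms.card := by simp
        _ ≤ (n + 1) * ∏ i, b i := Nat.mul_le_mul_left _ hb1
    · rw [Fin.sum_univ_succ]
      simp only [Fin.cons_zero, Fin.cons_succ]
      omega

/-- The inequality of arithmetic and geometric means for natural numbers with a product of at
least `k`. -/
theorem mul_rpow_inv_le_sum {d k : ℕ} (hd : 0 < d) {b : Fin d → ℕ} (h : k ≤ ∏ i, b i) :
    (d : ℝ) * (k : ℝ) ^ (1 / (d : ℝ)) ≤ ∑ i, (b i : ℝ) := by
  have hd' : (0 : ℝ) < d := by exact_mod_cast hd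
  have h1 := Real.geom_mean_le_arith_mean_weighted Finset.univ (fun _ : Fin d => 1 / (d : ℝ))
    (fun i => (b i : ℝ)) (fun _ _ => by positivity) (by simp [hd'.ne']) fun _ _ => by positivity
  rw [Real.finsetProd_rpow _ _ fun _ _ => by positivity, ← Finset.mul_sum] at h1
  have h2 : (k : ℝ) ^ (1 / (d : ℝ)) ≤ (∏ i, (b i : ℝ)) ^ (1 / (d : ℝ)) :=
    Real.rpow_le_rpow (by positivity) (by exact_mod_cast h) (by positivity)
  calc (d : ℝ) * (k : ℝ) ^ (1 / (d : ℝ)) ≤ d * (1 / d * ∑ i, (b i : ℝ)) :=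
        mul_le_mul_of_nonneg_left (h2.trans h1) hd'.le
    _ = _ := by field_simp

/-! ### The choice of the parameters -/

theorem three_le_of_two_le_ceil_logb {K D : ℕ} (h2 : 2 ≤ D)
    (hD : D ≤ ⌈Real.logb 2 (K : ℝ)⌉₊) : 3 ≤ K := by
  by_contra h
  have hK : K ≤ 2 := by omega
  have h1 : Real.logb 2 (K : ℝ) ≤ 1 := by
    rcases Nat.eq_zero_or_pos K with rfl | hpos
    · simp
    · calc Real.logb 2 (K : ℝ) ≤ Real.logb 2 2 :=
            Real.logb_le_logb_of_le one_lt_two (by exact_mod_cast hpos) (by exact_mod_cast hK)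
        _ = 1 := Real.logb_self_eq_one one_lt_two
  have h3 : ⌈Real.logb 2 (K : ℝ)⌉₊ ≤ 1 := Nat.ceil_le.2 (by simpa using h1)
  omega

theorem one_le_log_of_three_le {K : ℕ} (hK : 3 ≤ K) : 1 ≤ Real.log K := by
  have h : (3 : ℝ) ≤ K := by exact_mod_cast hK
  rw [Real.le_log_iff_exp_le (by linarith)]
  linarith [Real.exp_one_lt_d9]

theorem two_le_branchingNumber {K D : ℕ} (hK : 2 ≤ K) (hD : 0 < D) :
    2 ≤ branchingNumber K D := by
  have h : (1 : ℝ) < (K : ℝ) ^ (1 / (D : ℝ)) :=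
    Real.one_lt_rpow (by exact_mod_cast hK) (by positivity)
  have : 1 < branchingNumber K D := Nat.lt_ceil.2 (by simpa using h)
  omega

theorem branchingNumber_le_two_mul {K D : ℕ} (hK : 1 ≤ K) :
    (branchingNumber K D : ℝ) ≤ 2 * (K : ℝ) ^ (1 / (D : ℝ)) := by
  have h : (1 : ℝ) ≤ (K : ℝ) ^ (1 / (D : ℝ)) :=
    Real.one_le_rpow (by exact_mod_cast hK) (by positivity)
  have := Nat.ceil_lt_add_one (a := (K : ℝ) ^ (1 / (D : ℝ))) (by positivity)
  unfold branchingNumber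
  linarith

theorem branchingNumber_le {K D : ℕ} (hK : 1 ≤ K) (hD : 0 < D) : branchingNumber K D ≤ K := by
  refine Nat.ceil_le.2 ?_
  have hD' : (1 : ℝ) ≤ D := by exact_mod_cast hD
  calc (K : ℝ) ^ (1 / (D : ℝ)) ≤ (K : ℝ) ^ (1 : ℝ) :=
        Real.rpow_le_rpow_of_exponent_le (by exact_mod_cast hK)
          (div_le_one_of_le₀ hD' (by positivity))
    _ = K := Real.rpow_one _

theorem sqrt_rpow_one_div {x D : ℝ} (hx : 0 ≤ x) :
    Real.sqrt (x ^ (1 / D)) = x ^ (1 / (2 * D)) := by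
  rw [Real.sqrt_eq_rpow, ← Real.rpow_mul hx]
  congr 1
  ring

theorem sqrt_branchingNumber_mul_log_le {K D : ℕ} (hK : 2 ≤ K) (hD : 0 < D) :
    Real.sqrt (branchingNumber K D * Real.log (branchingNumber K D) / 2) ≤
      (K : ℝ) ^ (1 / (2 * (D : ℝ))) * Real.sqrt (Real.log K) := by
  rw [← sqrt_rpow_one_div (by positivity), ← Real.sqrt_mul (by positivity)]
  refine Real.sqrt_le_sqrt ?_
  have h1 := branchingNumber_le_two_mul (K := K) (D := D) (by omega)
  have h2 : (branchingNumber K D : ℝ) ≤ K := by exact_mod_cast branchingNumber_le (by omega) hD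
  have h3 : (0 : ℝ) < branchingNumber K D := by
    exact_mod_cast (by linarith [two_le_branchingNumber hK hD] : 0 < branchingNumber K D)
  have h4 := mul_le_mul h1 (Real.log_le_log h3 h2) (Real.log_natCast_nonneg _) (by positivity)
  linarith

theorem epochNumber_pos {D T : ℕ} (hT : 1 ≤ T) : 1 ≤ epochNumber D T :=
  Nat.ceil_pos.2 (Real.rpow_pos_of_pos (by exact_mod_cast hT) _)

theorem le_epochNumber_pow {D T : ℕ} (hD : 0 < D) : T ≤ epochNumber D T ^ D := by
  have : (T : ℝ) ≤ (epochNumber D T : ℝ) ^ D :=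
    calc (T : ℝ) = ((T : ℝ) ^ (1 / (D : ℝ))) ^ D := by
          rw [one_div, Real.rpow_inv_natCast_pow (by positivity) hD.ne']
      _ ≤ _ := pow_le_pow_left₀ (by positivity) (Nat.le_ceil _) D
  exact_mod_cast this

/-- The excess of `S ^ D` over `T` caused by rounding up is bounded as soon as `T ^ (1 / D)` is at
least `D`, because `(1 + 1 / D) ^ D ≤ e`. -/
theorem epochNumber_pow_le {D T : ℕ} (hD : 0 < D) (h : (D : ℝ) ≤ (T : ℝ) ^ (1 / (D : ℝ))) :
    (epochNumber D T : ℝ) ^ D ≤ 3 * T := by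
  have hD' : (0 : ℝ) < D := by exact_mod_cast hD
  set x := (T : ℝ) ^ (1 / (D : ℝ)) with hx
  have hxD : x ^ D = T := by
    rw [hx, one_div, Real.rpow_inv_natCast_pow (by positivity) hD.ne']
  have hx0 : 0 ≤ x := by positivity
  have h1 : (epochNumber D T : ℝ) ≤ x * Real.exp (1 / D) := by
    calc (epochNumber D T : ℝ) ≤ x + 1 := (Nat.ceil_lt_add_one hx0).le
      _ ≤ x + x / D := by
          have : 1 ≤ x / D := (one_le_div hD').2 h
          linarith
      _ = x * (1 / D + 1) := by ring
      _ ≤ _ := mul_le_mul_of_nonneg_left (Real.add_one_le_exp _) hx0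
  calc (epochNumber D T : ℝ) ^ D ≤ (x * Real.exp (1 / D)) ^ D :=
        pow_le_pow_left₀ (by positivity) h1 D
    _ = T * Real.exp 1 := by
        rw [mul_pow, hxD, ← Real.exp_nat_mul]
        congr 2
        field_simp
    _ ≤ 3 * T := by
        rw [mul_comm]
        exact mul_le_mul_of_nonneg_right (by linarith [Real.exp_one_lt_d9]) (by positivity)

/-! ### The memory requirement and the regret of HLMC -/

theorem expectedWeakRegret_eq {K : ℕ} (r : ℕ → Fin K → ℝ) (T : ℕ) {p : PMF (List (Play K))}
    (hp : p.support.Finite) :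
    expectedWeakRegret r T p =
      (⨆ i : Fin K, ∑ t ∈ Finset.range T, r t i) - expect p totalReward := by
  have := expect_affine hp (⨆ i : Fin K, ∑ t ∈ Finset.range T, r t i) (-1) totalReward
  have h2 : expectedWeakRegret r T p =
      expect p fun l => (⨆ i : Fin K, ∑ t ∈ Finset.range T, r t i) + -1 * totalReward l := by
    simp only [expectedWeakRegret, expect, weakRegret, neg_one_mul, sub_eq_add_neg]
  rw [h2, this]
  ring

theorem exists_isMemoryRequirement_hlmc {K D T : ℕ} (hD : 0 < D) (hT : 1 ≤ T) (aux : ℕ)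
    {H : Hierarchy K D} (hH : H.IsHLMC) (r : ℕ → Fin K → ℝ) :
    ∃ M : ℕ, IsMemoryRequirement (hlmc H T aux r) M ∧
      (D : ℝ) * (K : ℝ) ^ (1 / (D : ℝ)) ≤ M ∧ M ≤ D * (branchingNumber K D + aux) := by
  set A := {m : ℕ | ∃ l ∈ (hlmc H T aux r).support, ∃ x ∈ l, x.words = m} with hA
  have hub : ∀ m ∈ A, m ≤ D * (branchingNumber K D + aux) := by
    rintro m ⟨l, hl, x, hx, rfl⟩
    simpa using hlmcEpoch_words_le H hH.2 0 0 T l hl x hx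
  obtain ⟨l, hl, x, hx, b, hb1, hb2⟩ := hlmcEpoch_exists_words_ge (r := r) (aux := aux)
    (γ := learningRate (branchingNumber K D) (epochNumber D T)) (epochNumber_pos (D := D) hT) H
    0 0 T hT
  have hmem : x.words ∈ A := ⟨l, hl, x, hx, rfl⟩
  have hbdd : BddAbove A := ⟨_, hub⟩
  refine ⟨sSup A, ⟨Nat.sSup_mem ⟨_, hmem⟩ hbdd, fun m hm => le_csSup hbdd hm⟩, ?_,
    hub _ (Nat.sSup_mem ⟨_, hmem⟩ hbdd)⟩
  have hcard : H.arms.card = K := by rw [hH.1]; simp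
  rw [hcard] at hb1
  have h1 : ∑ i, b i ≤ sSup A := by
    have := le_csSup hbdd hmem
    omega
  exact (mul_rpow_inv_le_sum hD hb1).trans (by exact_mod_cast h1)

theorem expectedWeakRegret_hlmc_le {K D T : ℕ} (hK : 3 ≤ K) (hD : 0 < D) (hT : 1 ≤ T) (aux : ℕ)
    {H : Hierarchy K D} (hH : H.IsHLMC) {r : ℕ → Fin K → ℝ}
    (hr : ∀ t i, r t i ∈ Set.Icc (0 : ℝ) 1) :
    expectedWeakRegret r T (hlmc H T aux r) ≤
      15 * ((D : ℝ) * (T : ℝ) ^ (1 - 1 / (2 * (D : ℝ))) * (K : ℝ) ^ (1 / (2 * (D : ℝ)))) *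
        Real.sqrt (Real.log (K : ℝ)) := by
  have hfin : (hlmc H T aux r).support.Finite := hlmcEpoch_finite_support _ _ _ _ _ _ _ _
  rw [expectedWeakRegret_eq r T hfin]
  have : Nonempty (Fin K) := ⟨⟨0, by omega⟩⟩
  obtain ⟨a, ha⟩ := exists_eq_ciSup_of_finite (f := fun i : Fin K => ∑ t ∈ Finset.range T, r t i)
  rw [← ha]
  set R := ∑ t ∈ Finset.range T, r t a - expect (hlmc H T aux r) totalReward with hR
  have hRT : R ≤ T := by
    have h1 : ∑ t ∈ Finset.range T, r t a ≤ T :=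
      (Finset.sum_le_sum fun i _ => (hr i a).2).trans (by simp)
    have h2 : 0 ≤ expect (hlmc H T aux r) totalReward :=
      le_expect hfin fun l hl => totalReward_nonneg (hlmcEpoch_reward_mem hr _ _ _ _ _ _ _ l hl)
    linarith
  have hN2 := two_le_branchingNumber (K := K) (by omega) hD
  have hS1 : 1 ≤ epochNumber D T := epochNumber_pos hT
  have hreg : 0 < (learningRate (branchingNumber K D) (epochNumber D T) : ℝ) →
      epochNumber D T * R ≤ _ := fun hγ => by
    have h := hlmcEpoch_regret_le hr hS1 hγ aux H hH.2 a (by rw [hH.1]; simp) 0 0 T hT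
      (le_epochNumber_pow hD)
    simp only [zero_add] at h
    exact h
  have hsqrtN := sqrt_branchingNumber_mul_log_le (K := K) (D := D) (by omega) hD
  set κ := (K : ℝ) ^ (1 / (2 * (D : ℝ))) * Real.sqrt (Real.log K) with hκ
  set u := (T : ℝ) ^ (1 - 1 / (2 * (D : ℝ))) with hu
  set x := (T : ℝ) ^ (1 / (D : ℝ)) with hx
  have hT0 : (0 : ℝ) < T := by exact_mod_cast hT
  have hD1 : (1 : ℝ) ≤ D := by exact_mod_cast hD
  have hx0 : 0 < x := by positivity
  have hu0 : 0 < u := by positivity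
  have hκ1 : 1 ≤ κ := by
    refine one_le_mul_of_one_le_of_one_le (Real.one_le_rpow ?_ (by positivity)) ?_
    · exact_mod_cast (by omega : 1 ≤ K)
    · exact Real.one_le_sqrt.2 (one_le_log_of_three_le hK)
  have hTu : (T : ℝ) = u * Real.sqrt x := by
    rw [hx, hu, sqrt_rpow_one_div hT0.le, ← Real.rpow_add hT0]
    simp
  have hgoal : 15 * ((D : ℝ) * u * (K : ℝ) ^ (1 / (2 * (D : ℝ)))) * Real.sqrt (Real.log (K : ℝ)) =
      15 * (D * (u * κ)) := by rw [hκ]; ring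
  rw [hgoal]
  have hDuκ : u * κ ≤ D * (u * κ) := le_mul_of_one_le_left (by positivity) hD1
  have huκ : 0 < u * κ := by positivity
  -- For `T ^ (1 / D) < D` the trivial bound `T` suffices.
  rcases lt_or_ge x D with hxD | hxD
  · have h1 : Real.sqrt x ≤ D := by
      rw [Real.sqrt_le_left (by linarith)]
      nlinarith
    have h2 : u * Real.sqrt x ≤ u * κ * D :=
      mul_le_mul (le_mul_of_one_le_right hu0.le hκ1) h1 (by positivity) huκ.le
    linarith
  have hSpow := epochNumber_pow_le hD hxD
  have hxS : x ≤ epochNumber D T := Nat.le_ceil _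
  set N : ℝ := ((branchingNumber K D : ℕ) : ℝ) with hNdef
  set S : ℝ := ((epochNumber D T : ℕ) : ℝ) with hSdef
  have hS : (1 : ℝ) ≤ S := Nat.one_le_cast.2 hS1
  have hN : (2 : ℝ) ≤ N := Nat.ofNat_le_cast.2 hN2
  have hlogN : 0 < Real.log N := Real.log_pos (by linarith)
  set v := N * Real.log N / (2 * S) with hv
  have hv0 : 0 < v := by positivity
  have hNv : N * Real.log N / 2 = S * v := by rw [hv]; field_simp
  rw [hNv, Real.sqrt_mul (by linarith)] at hsqrtN
  have hγval : (learningRate (branchingNumber K D) (epochNumber D T) : ℝ) =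
      min 1 (Real.sqrt v) := rfl
  rcases le_or_gt 1 (Real.sqrt v) with hv1 | hv1
  -- If the learning rate is capped, then `S ≤ N * log N / 2`, and the trivial bound `T` suffices.
  · have h1 : Real.sqrt x ≤ κ :=
      (Real.sqrt_le_sqrt hxS).trans
        ((le_mul_of_one_le_right (Real.sqrt_nonneg _) hv1).trans hsqrtN)
    have h2 := mul_le_mul_of_nonneg_left h1 hu0.le
    linarith
  · rw [hγval, min_eq_right hv1.le] at hreg
    have hq := Real.sqrt_pos.2 hv0
    have h := hreg hq
    have hsqS : 0 < Real.sqrt S := Real.sqrt_pos.2 (by linarith)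
    have hNq : N * Real.log N / Real.sqrt v = 2 * S * Real.sqrt v := by
      rw [div_eq_iff hq.ne', mul_assoc, Real.mul_self_sqrt hv0.le]
      linarith
    rw [hNq] at h
    -- Both `S * √v` and `1` are at most `√S * κ`.
    have h1 : S * Real.sqrt v ≤ Real.sqrt S * κ := by
      calc S * Real.sqrt v = Real.sqrt S * (Real.sqrt S * Real.sqrt v) := by
            rw [← mul_assoc, Real.mul_self_sqrt (by linarith)]
        _ ≤ _ := mul_le_mul_of_nonneg_left hsqrtN hsqS.le
    have h2 : 1 ≤ Real.sqrt S * κ := one_le_mul_of_one_le_of_one_le (Real.one_le_sqrt.2 hS) hκ1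
    have h3 : S * R ≤ D * (3 * T) * (5 * (Real.sqrt S * κ)) :=
      h.trans (mul_le_mul (mul_le_mul_of_nonneg_left hSpow (by linarith)) (by linarith)
        (by positivity) (by positivity))
    have h4 : (T : ℝ) * Real.sqrt S ≤ u * S := by
      rw [hTu]
      calc u * Real.sqrt x * Real.sqrt S ≤ u * Real.sqrt S * Real.sqrt S := by gcongr
        _ = u * S := by rw [mul_assoc, Real.mul_self_sqrt (by linarith)]
    have h5 : S * R ≤ S * (15 * (D * (u * κ))) := by
      have := mul_le_mul_of_nonneg_left h4 (by positivity : 0 ≤ 15 * (D * κ))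
      linarith
    exact le_of_mul_le_mul_left h5 (by linarith)

theorem mainTheorem7 (aux : ℕ) :
    ∃ c₁ c₂ C : ℝ, 0 < c₁ ∧ 0 < c₂ ∧ 0 < C ∧
      ∀ K D T : ℕ, 2 ≤ D → D ≤ ⌈Real.logb 2 (K : ℝ)⌉₊ → 1 ≤ T →
      ∀ H : Hierarchy K D, H.IsHLMC →
      ∀ r : ℕ → Fin K → ℝ, (∀ t i, r t i ∈ Set.Icc (0 : ℝ) 1) →
        (∃ M : ℕ, IsMemoryRequirement (hlmc H T aux r) M ∧
          c₁ * ((D : ℝ) * (K : ℝ) ^ (1 / (D : ℝ))) ≤ (M : ℝ) ∧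
          (M : ℝ) ≤ c₂ * ((D : ℝ) * (K : ℝ) ^ (1 / (D : ℝ)))) ∧
        expectedWeakRegret r T (hlmc H T aux r) ≤
          C * ((D : ℝ) * (T : ℝ) ^ (1 - 1 / (2 * (D : ℝ))) * (K : ℝ) ^ (1 / (2 * (D : ℝ)))) *
            Real.sqrt (Real.log (K : ℝ)) := by
  refine ⟨1, 2 + aux, 15, one_pos, by positivity, by norm_num, ?_⟩
  intro K D T h2 hD hT H hH r hr
  have hK := three_le_of_two_le_ceil_logb h2 hD
  refine ⟨?_, expectedWeakRegret_hlmc_le hK (by omega) hT aux hH hr⟩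
  obtain ⟨M, hM, hlow, hup⟩ := exists_isMemoryRequirement_hlmc (by omega) hT aux hH r
  refine ⟨M, hM, by simpa using hlow, ?_⟩
  have h1 : (1 : ℝ) ≤ (K : ℝ) ^ (1 / (D : ℝ)) :=
    Real.one_le_rpow (by exact_mod_cast (by omega : 1 ≤ K)) (by positivity)
  have h3 := branchingNumber_le_two_mul (K := K) (D := D) (by omega)
  have h4 : (aux : ℝ) ≤ aux * (K : ℝ) ^ (1 / (D : ℝ)) := le_mul_of_one_le_right (by positivity) h1
  calc (M : ℝ) ≤ D * (branchingNumber K D + aux) := by exact_mod_cast hup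
    _ ≤ D * ((2 + aux) * (K : ℝ) ^ (1 / (D : ℝ))) :=
        mul_le_mul_of_nonneg_left (by linarith) (by positivity)
    _ = _ := by ring
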